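/- Let $d\in\{2,3\}$, let $\Omega\subset\mathbb{R}^d$ be a bounded open set (in particular, any bounded polygonal or polyhedral domain with Lipschitz boundary), let $\varepsilon>0$ and $f\in L^2(\Omega)$. Write $(\cdot,\cdot)$ for the $L^2(\Omega)$ inner product, $H^m(\Omega)$ for the Sobolev spaces of functions with weak derivatives up to order $m$ in $L^2(\Omega)$, and $H^1_0(\Omega)$ for the closure of $C_c^\infty(\Omega)$ in $H^1(\Omega)$. The mixed weak formulation of $\varepsilon^2\Delta^2u-\Delta u=f$ in $\Omega$, $u=\Delta u=0$ on $\partial\Omega$ (with $\psi=-\Delta u$) is: find $(\psi,u)\in H^1_0(\Omega)\times H^1_0(\Omega)$ such that $$\varepsilon^2(\nabla\psi,\nabla\varphi)+(\psi,\varphi)=(f,\varphi)\quad\forall\varphi\in H^1_0(\Omega),\qquad (\nabla u,\nabla v)=(\psi,v)\quad\forall v\in H^1_0(\Omega).\tag{1}$$ The primal weak formulation is: find $\tilde u\in H^2(\Omega)\cap H^1_0(\Omega)$ such that $$\varepsilon^2(\Delta\tilde u,\Delta v)+(\nabla\tilde u,\nabla v)=(f,v)\quad\forall v\in H^2(\Omega)\cap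 H^1_0(\Omega).\tag{2}$$ Theorem. Problem (1) has exactly one solution $(\psi,u)$, and problem (2) has at most one solution. The function $u$ determined by (1) is the solution of (2) if and only if $u\in H^2(\Omega)$. Consequently, whenever $\tilde u$ is a solution of (2), $\tilde u=u$ if and only if $u\in H^2(\Omega)$. -/

import Mathlib

open MeasureTheory Set
open scoped ContDiff ENNReal InnerProductSpace

noncomputable section

namespace MixedPlate

/-- `ℝ^d` with its Euclidean structure. -/
abbrev Space (d : ℕ) : Type := EuclideanSpace ℝ (Fin d)

/-- The Hilbert space `L²(Ω)` of real functions on `Ω ⊆ ℝ^d` (almost-everywhere classes for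
Lebesgue measure on `Ω`). Its inner product `⟪u, v⟫_ℝ` is `∫_Ω u v`. -/
abbrev L2 {d : ℕ} (Ω : Set (Space d)) : Type :=
  Lp ℝ 2 ((volume : Measure (Space d)).restrict Ω)

/-- The classical partial derivative `∂φ/∂x_i`. -/
def partialDeriv {d : ℕ} (i : Fin d) (φ : Space d → ℝ) (x : Space d) : ℝ :=
  fderiv ℝ φ x (EuclideanSpace.single i 1)

/-- `φ ∈ C_c^∞(Ω)`. -/
def IsTestFunction {d : ℕ} (Ω : Set (Space d)) (φ : Space d → ℝ) : Prop :=
  ContDiff ℝ ∞ φ ∧ HasCompactSupport φ ∧ tsupport φ ⊆ Ω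

/-- `g ∈ L²(Ω)` is the weak partial derivative `∂u/∂x_i` of `u ∈ L²(Ω)`. -/
def HasWeakPartial {d : ℕ} (Ω : Set (Space d)) (i : Fin d) (u g : L2 Ω) : Prop :=
  ∀ φ : Space d → ℝ, IsTestFunction Ω φ →
    ∫ x in Ω, u x * partialDeriv i φ x = -∫ x in Ω, g x * φ x

/-- On an open set the weak partial derivative is unique. -/
theorem HasWeakPartial.unique {d : ℕ} {Ω : Set (Space d)} (hΩ : IsOpen Ω) {i : Fin d}
    {u g h : L2 Ω} (hg : HasWeakPartial Ω i u g) (hh : HasWeakPartial Ω i u h) : g = h := by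
  have loc : ∀ w : L2 Ω, LocallyIntegrable w ((volume : Measure (Space d)).restrict Ω) :=
    fun w => (Lp.memLp w).locallyIntegrable (by norm_num)
  have key := hΩ.ae_eq_zero_of_integral_contDiff_smul_eq_zero
    (μ := (volume : Measure (Space d)).restrict Ω) (f := fun x => g x - h x)
    (((loc g).sub (loc h)).locallyIntegrableOn Ω) (by
      intro φ h1 h2 h3
      have int : ∀ w : L2 Ω, Integrable (fun x => φ x * w x)
          ((volume : Measure (Space d)).restrict Ω) := fun w => by
        simpa [smul_eq_mul] using
          (loc w).integrable_smul_left_of_hasCompactSupport h1.continuous h2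
      have e := (hg φ ⟨h1, h2, h3⟩).symm.trans (hh φ ⟨h1, h2, h3⟩)
      simp only [smul_eq_mul, mul_sub]
      rw [integral_sub (int g) (int h)]
      simp only [mul_comm (φ _)]
      linarith)
  apply Lp.ext
  have m : ∀ᵐ x ∂((volume : Measure (Space d)).restrict Ω), x ∈ Ω :=
    ae_restrict_mem hΩ.measurableSet
  filter_upwards [key, m] with x hx hm
  exact sub_eq_zero.mp (hx hm)

open Classical in
/-- The weak partial derivative `∂u/∂x_i ∈ L²(Ω)`, when it exists (and `0` otherwise). -/
def weakPartial {d : ℕ} (Ω : Set (Space d)) (i : Fin d) (u : L2 Ω) : L2 Ω :=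
  if h : ∃ g : L2 Ω, HasWeakPartial Ω i u g then h.choose else 0

theorem HasWeakPartial.weakPartial_eq {d : ℕ} {Ω : Set (Space d)} (hΩ : IsOpen Ω) {i : Fin d}
    {u g : L2 Ω} (hg : HasWeakPartial Ω i u g) : weakPartial Ω i u = g := by
  have h : ∃ g : L2 Ω, HasWeakPartial Ω i u g := ⟨g, hg⟩
  rw [weakPartial, dif_pos h]
  exact HasWeakPartial.unique hΩ h.choose_spec hg

/-- The Sobolev space `H¹(Ω)`: all first weak partial derivatives exist in `L²(Ω)`. -/
def H1 {d : ℕ} (Ω : Set (Space d)) : Set (L2 Ω) :=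
  {u | ∀ i : Fin d, ∃ g : L2 Ω, HasWeakPartial Ω i u g}

/-- The Sobolev space `H²(Ω)`: all weak partial derivatives of order at most two exist in
`L²(Ω)`. -/
def H2 {d : ℕ} (Ω : Set (Space d)) : Set (L2 Ω) :=
  {u | u ∈ H1 Ω ∧ ∀ i : Fin d, weakPartial Ω i u ∈ H1 Ω}

/-- The space `H¹₀(Ω)`: the closure of `C_c^∞(Ω)` in `H¹(Ω)` for the `H¹` norm. -/
def H10 {d : ℕ} (Ω : Set (Space d)) : Set (L2 Ω) :=
  {u | u ∈ H1 Ω ∧ ∀ η : ℝ≥0∞, 0 < η → ∃ φ : Space d → ℝ, IsTestFunction Ω φ ∧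
    eLpNorm (fun x => u x - φ x) 2 (volume.restrict Ω) < η ∧
    ∀ i : Fin d,
      eLpNorm (fun x => weakPartial Ω i u x - partialDeriv i φ x) 2 (volume.restrict Ω) < η}

/-- `(∇u, ∇v) = ∫_Ω ∇u · ∇v`, for `u, v ∈ H¹(Ω)`. -/
def gradInner {d : ℕ} (Ω : Set (Space d)) (u v : L2 Ω) : ℝ :=
  ∑ i : Fin d, ⟪weakPartial Ω i u, weakPartial Ω i v⟫_ℝ

/-- The Laplacian `Δu ∈ L²(Ω)`, for `u ∈ H²(Ω)`. -/
def weakLaplacian {d : ℕ} (Ω : Set (Space d)) (u : L2 Ω) : L2 Ω :=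
  ∑ i : Fin d, weakPartial Ω i (weakPartial Ω i u)

/-- `(ψ, u)` is a weak solution of the mixed problem `-ε²Δψ + ψ = f`, `-Δu = ψ` in `Ω`,
`u = ψ = 0` on `∂Ω`. -/
def IsMixedWeakSolution {d : ℕ} (Ω : Set (Space d)) (ε : ℝ) (f ψ u : L2 Ω) : Prop :=
  ψ ∈ H10 Ω ∧ u ∈ H10 Ω ∧
  (∀ φ ∈ H10 Ω, ε ^ 2 * gradInner Ω ψ φ + ⟪ψ, φ⟫_ℝ = ⟪f, φ⟫_ℝ) ∧
  (∀ v ∈ H10 Ω, gradInner Ω u v = ⟪ψ, v⟫_ℝ)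

/-- `w` is a solution in `H²(Ω) ∩ H¹₀(Ω)` of the primal weak formulation of
`ε²Δ²w - Δw = f` in `Ω`, `w = Δw = 0` on `∂Ω`. -/
def IsPrimalWeakSolution {d : ℕ} (Ω : Set (Space d)) (ε : ℝ) (f w : L2 Ω) : Prop :=
  w ∈ H2 Ω ∩ H10 Ω ∧
  ∀ v ∈ H2 Ω ∩ H10 Ω,
    ε ^ 2 * ⟪weakLaplacian Ω w, weakLaplacian Ω v⟫_ℝ + gradInner Ω w v = ⟪f, v⟫_ℝ

end MixedPlate

end

noncomputable section

namespace MixedPlate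

variable {d : ℕ} {Ω : Set (Space d)}

/-! ### Test functions -/

namespace IsTestFunction

/-! The mixed system is triangular: the first equation determines ψ, and the second then determines
u. Each is solved by Lax–Milgram on the closure of the pairs (φ, ∇φ) in L² × (L²)^d, a Hilbert space
that is identified with H¹₀; coercivity is the Poincaré inequality, obtained by density from test
functions (`existsUnique_elliptic`). If u ∈ H², Green's formula against H¹₀ and density give Δu =
-ψ. For v ∈ H² ∩ H¹₀, Green's formula for v against ψ ∈ H¹₀ gives ε²(Δu, Δv) = -ε²(ψ, Δv) = ε²(∇ψ,
∇v). Adding (∇u, ∇v) = (ψ, v) yields the first mixed equation tested with v, so u solves the primal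
problem. Conversely, a primal solution lies in H² by definition. Primal uniqueness is an energy
estimate for the difference. Every integration by parts has one factor in H¹₀, so no boundary
regularity is needed. -/

theorem memLp {φ : Space d → ℝ} (h : IsTestFunction Ω φ) :
    MemLp φ 2 ((volume : Measure (Space d)).restrict Ω) :=
  h.1.continuous.memLp_of_hasCompactSupport h.2.1

theorem partialDeriv {φ : Space d → ℝ} (h : IsTestFunction Ω φ) (i : Fin d) :
    IsTestFunction Ω (partialDeriv i φ) := by
  refine ⟨(h.1.fderiv_right (m := ∞) (by simp)).clm_apply contDiff_const,
    h.2.1.fderiv_apply (𝕜 := ℝ) _, (tsupport_fderiv_apply_subset ℝ _).trans h.2.2⟩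

theorem const_smul {φ : Space d → ℝ} (h : IsTestFunction Ω φ) (c : ℝ) :
    IsTestFunction Ω (c • φ) :=
  ⟨contDiff_const.smul h.1, h.2.1.smul_left (f := fun _ => c),
    (tsupport_smul_subset_right (fun _ => c) φ).trans h.2.2⟩

theorem add {φ χ : Space d → ℝ} (h : IsTestFunction Ω φ) (h' : IsTestFunction Ω χ) :
    IsTestFunction Ω (φ + χ) :=
  ⟨h.1.add h'.1, h.2.1.add h'.2.1,
    (tsupport_add φ χ).trans (union_subset h.2.2 h'.2.2)⟩

theorem zero : IsTestFunction Ω (0 : Space d → ℝ) :=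
  ⟨contDiff_const, HasCompactSupport.zero, by simp [tsupport]⟩

theorem mul_left {g φ : Space d → ℝ} (hg : ContDiff ℝ ∞ g) (h : IsTestFunction Ω φ) :
    IsTestFunction Ω (fun x => g x * φ x) :=
  ⟨hg.mul h.1, h.2.1.mul_left, (tsupport_mul_subset_right (f := g)).trans h.2.2⟩

theorem eq_zero_of_notMem {φ : Space d → ℝ} (h : IsTestFunction Ω φ) {x : Space d}
    (hx : x ∉ Ω) : φ x = 0 :=
  image_eq_zero_of_notMem_tsupport fun hx' => hx (h.2.2 hx')

theorem integrable {φ : Space d → ℝ} (h : IsTestFunction Ω φ) (μ : Measure (Space d))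
    [IsFiniteMeasureOnCompacts μ] : Integrable φ μ :=
  h.1.continuous.integrable_of_hasCompactSupport h.2.1

/-- Integration by parts against a test function has no boundary term. -/
theorem integral_mul_partialDeriv {g φ : Space d → ℝ} (hg : ContDiff ℝ ∞ g)
    (h : IsTestFunction Ω φ) (i : Fin d) :
    ∫ x in Ω, g x * MixedPlate.partialDeriv i φ x =
      -∫ x in Ω, MixedPlate.partialDeriv i g x * φ x := by
  have hg' : ContDiff ℝ ∞ (MixedPlate.partialDeriv i g) :=
    (hg.fderiv_right (m := ∞) (by simp)).clm_apply contDiff_const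
  -- Both integrands vanish off Ω, so the integrals may be taken over the whole space.
  rw [setIntegral_eq_integral_of_forall_compl_eq_zero
      fun x hx => by rw [(h.partialDeriv i).eq_zero_of_notMem hx, mul_zero],
    setIntegral_eq_integral_of_forall_compl_eq_zero
      fun x hx => by rw [h.eq_zero_of_notMem hx, mul_zero]]
  exact integral_mul_fderiv_eq_neg_fderiv_mul_of_integrable
    ((mul_left hg' h).integrable volume) ((mul_left hg (h.partialDeriv i)).integrable volume)
    ((mul_left hg h).integrable volume)
    (fun x _ => (hg.differentiable (by simp)).differentiableAt)
    (fun x _ => (h.1.differentiable (by simp)).differentiableAt)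

end IsTestFunction

theorem partialDeriv_mul {g h : Space d → ℝ} (hg : Differentiable ℝ g) (hh : Differentiable ℝ h)
    (i : Fin d) (x : Space d) :
    partialDeriv i (fun y => g y * h y) x =
      g x * partialDeriv i h x + partialDeriv i g x * h x := by
  simp only [partialDeriv]
  rw [fderiv_fun_mul (hg x) (hh x)]
  simp [mul_comm]

theorem partialDeriv_add {g h : Space d → ℝ} (hg : Differentiable ℝ g) (hh : Differentiable ℝ h)
    (i : Fin d) : partialDeriv i (g + h) = partialDeriv i g + partialDeriv i h := by
  ext x
  simp [partialDeriv, fderiv_add (hg x) (hh x)]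

theorem partialDeriv_const_smul {g : Space d → ℝ} (hg : Differentiable ℝ g) (c : ℝ) (i : Fin d) :
    partialDeriv i (c • g) = c • partialDeriv i g := by
  ext x
  simp [partialDeriv, fderiv_const_smul (hg x)]

theorem partialDeriv_coord (i : Fin d) (x : Space d) :
    partialDeriv i (fun y : Space d => y i) x = 1 := by
  have : (fun y : Space d => y i) = (EuclideanSpace.proj i : Space d →L[ℝ] ℝ) := rfl
  rw [partialDeriv, this, ContinuousLinearMap.fderiv]
  simp

theorem contDiff_coord (i : Fin d) : ContDiff ℝ ∞ (fun y : Space d => y i) :=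
  (EuclideanSpace.proj i : Space d →L[ℝ] ℝ).contDiff

/-- The Poincaré inequality for a test function. -/
theorem IsTestFunction.integral_sq_le {φ : Space d → ℝ} (hΩ : MeasurableSet Ω)
    (h : IsTestFunction Ω φ) (i : Fin d) {R : ℝ} (hR : ∀ x ∈ Ω, ‖x‖ ≤ R) :
    ∫ x in Ω, φ x ^ 2 ≤ (2 * R) ^ 2 * ∫ x in Ω, MixedPlate.partialDeriv i φ x ^ 2 := by
  have hd : Differentiable ℝ φ := h.1.differentiable (by simp)
  have hc := contDiff_coord i
  -- Since ∂(x_i)/∂x_i = 1, integrating φ ∂_i(x_i φ) by parts gives ∫ φ² = -2 ∫ x_i φ ∂_iφ.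
  have hpar := integral_mul_partialDeriv h.1 (mul_left hc h) i
  have I1 : Integrable (fun x => φ x ^ 2) (volume.restrict Ω) := h.memLp.integrable_sq
  have I2 : Integrable (fun x => MixedPlate.partialDeriv i φ x ^ 2) (volume.restrict Ω) :=
    (h.partialDeriv i).memLp.integrable_sq
  have I3 : Integrable (fun x => x i * φ x * MixedPlate.partialDeriv i φ x)
      (volume.restrict Ω) := by
    have := (mul_left (hc.mul h.1) (h.partialDeriv i)).integrable (volume.restrict Ω)
    simpa only [mul_assoc] using this
  have e1 : ∀ x, φ x * MixedPlate.partialDeriv i (fun y => y i * φ y) x =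
      x i * φ x * MixedPlate.partialDeriv i φ x + φ x ^ 2 := fun x => by
    rw [partialDeriv_mul (hc.differentiable (by simp)) hd, partialDeriv_coord]
    ring
  have e2 : ∀ x, MixedPlate.partialDeriv i φ x * (x i * φ x) =
      x i * φ x * MixedPlate.partialDeriv i φ x := fun x => by ring
  simp only [e1, e2] at hpar
  rw [integral_add I3 I1] at hpar
  -- Young's inequality, from (φ + 2 x_i ∂_iφ)² ≥ 0 and |x_i| ≤ R; the weight 1/2 lets the φ² term
  -- be absorbed on the left.
  have key : ∫ x in Ω, -2 * (x i * φ x * MixedPlate.partialDeriv i φ x) ≤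
      ∫ x in Ω, (1 / 2 * φ x ^ 2 + 2 * R ^ 2 * MixedPlate.partialDeriv i φ x ^ 2) := by
    refine setIntegral_mono_on (I3.const_mul _) ((I1.const_mul _).add (I2.const_mul _)) hΩ
      fun x hx => ?_
    have hx' : (x i) ^ 2 ≤ R ^ 2 :=
      sq_le_sq' (by linarith [abs_le.mp ((PiLp.norm_apply_le x i).trans (hR x hx))])
        (abs_le.mp ((PiLp.norm_apply_le x i).trans (hR x hx))).2
    nlinarith [sq_nonneg (φ x + 2 * (x i * MixedPlate.partialDeriv i φ x)),
      mul_le_mul_of_nonneg_right hx' (sq_nonneg (MixedPlate.partialDeriv i φ x))]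
  rw [integral_const_mul, integral_add (I1.const_mul _) (I2.const_mul _), integral_const_mul,
    integral_const_mul] at key
  linarith

/-! ### Weak derivatives -/

theorem inner_eq_integral {u v : L2 Ω} {φ : Space d → ℝ}
    (h : v =ᵐ[(volume : Measure (Space d)).restrict Ω] φ) :
    ⟪u, v⟫_ℝ = ∫ x in Ω, u x * φ x := by
  rw [L2.inner_def]
  refine integral_congr_ae ?_
  filter_upwards [h] with x hx
  simp [hx, mul_comm]

theorem norm_sq_eq_integral {v : L2 Ω} {φ : Space d → ℝ}
    (h : v =ᵐ[(volume : Measure (Space d)).restrict Ω] φ) :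
    ‖v‖ ^ 2 = ∫ x in Ω, φ x ^ 2 := by
  rw [← real_inner_self_eq_norm_sq, inner_eq_integral h]
  refine integral_congr_ae ?_
  filter_upwards [h] with x hx
  rw [hx, sq]

/-- The Hilbert space `L²(Ω) × L²(Ω)^d` in which `H¹(Ω)` is embedded by `u ↦ (u, ∇u)`. -/
abbrev GraphSpace {d : ℕ} (Ω : Set (Space d)) : Type :=
  WithLp 2 (L2 Ω × PiLp 2 fun _ : Fin d => L2 Ω)

/-- The pairs `(φ, ∇φ)` with `φ ∈ C_c^∞(Ω)`. -/
def testGraph {d : ℕ} (Ω : Set (Space d)) : Submodule ℝ (GraphSpace Ω) where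
  carrier := {p | ∃ φ, IsTestFunction Ω φ ∧ p.fst =ᵐ[volume.restrict Ω] φ ∧
    ∀ i, p.snd i =ᵐ[volume.restrict Ω] partialDeriv i φ}
  add_mem' := by
    rintro p q ⟨φ, h, h1, h2⟩ ⟨χ, k, k1, k2⟩
    refine ⟨φ + χ, h.add k, (Lp.coeFn_add _ _).trans (h1.add k1), fun i => ?_⟩
    rw [partialDeriv_add (h.1.differentiable (by simp)) (k.1.differentiable (by simp))]
    exact (Lp.coeFn_add _ _).trans ((h2 i).add (k2 i))
  zero_mem' := by
    refine ⟨0, IsTestFunction.zero, Lp.coeFn_zero _ _ _, fun i => ?_⟩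
    have : partialDeriv i (0 : Space d → ℝ) = 0 := by ext x; simp [partialDeriv]
    rw [this]
    exact Lp.coeFn_zero _ _ _
  smul_mem' := by
    rintro c p ⟨φ, h, h1, h2⟩
    refine ⟨c • φ, h.const_smul c, (Lp.coeFn_smul _ _).trans (h1.const_smul c), fun i => ?_⟩
    rw [partialDeriv_const_smul (h.1.differentiable (by simp))]
    exact (Lp.coeFn_smul _ _).trans ((h2 i).const_smul c)

/-- The closure of the pairs `(φ, ∇φ)` with `φ ∈ C_c^∞(Ω)`, which is the graph of the gradient
on `H¹₀(Ω)`. -/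
def H10Graph {d : ℕ} (Ω : Set (Space d)) : Submodule ℝ (GraphSpace Ω) :=
  (testGraph Ω).topologicalClosure

instance : CompleteSpace (H10Graph Ω) :=
  (testGraph Ω).isClosed_topologicalClosure.completeSpace_coe

/-- The element `(φ, ∇φ)` of `testGraph Ω`. -/
def IsTestFunction.pair {φ : Space d → ℝ} (h : IsTestFunction Ω φ) : GraphSpace Ω :=
  WithLp.toLp 2 (h.memLp.toLp φ, WithLp.toLp 2 fun i => (h.partialDeriv i).memLp.toLp _)

theorem IsTestFunction.pair_mem {φ : Space d → ℝ} (h : IsTestFunction Ω φ) :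
    h.pair ∈ testGraph Ω :=
  ⟨φ, h, MemLp.coeFn_toLp h.memLp, fun i => MemLp.coeFn_toLp (h.partialDeriv i).memLp⟩

/-- Recasts the integral definition as Hilbert-space identities, which are linear and continuous in
u and g. -/
theorem hasWeakPartial_iff {i : Fin d} {u g : L2 Ω} :
    HasWeakPartial Ω i u g ↔
      ∀ p ∈ testGraph Ω, ⟪u, p.snd i⟫_ℝ = -⟪g, p.fst⟫_ℝ := by
  constructor
  · rintro hu p ⟨φ, h, h1, h2⟩
    rw [inner_eq_integral (h2 i), inner_eq_integral h1]
    exact hu φ h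
  · intro hu φ h
    have := hu h.pair h.pair_mem
    rwa [inner_eq_integral (v := h.pair.snd i) (MemLp.coeFn_toLp (h.partialDeriv i).memLp),
      inner_eq_integral (v := h.pair.fst) (MemLp.coeFn_toLp h.memLp)] at this

theorem HasWeakPartial.sub {i : Fin d} {u g v h : L2 Ω} (hu : HasWeakPartial Ω i u g)
    (hv : HasWeakPartial Ω i v h) : HasWeakPartial Ω i (u - v) (g - h) := by
  rw [hasWeakPartial_iff] at *
  intro p hp
  rw [inner_sub_left, inner_sub_left, hu p hp, hv p hp]
  ring

theorem hasWeakPartial_weakPartial {u : L2 Ω} (hu : u ∈ H1 Ω) (i : Fin d) :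
    HasWeakPartial Ω i u (weakPartial Ω i u) := by
  rw [weakPartial, dif_pos (hu i)]
  exact (hu i).choose_spec

theorem weakPartial_sub (hΩ : IsOpen Ω) {u v : L2 Ω} (hu : u ∈ H1 Ω) (hv : v ∈ H1 Ω)
    (i : Fin d) : weakPartial Ω i (u - v) = weakPartial Ω i u - weakPartial Ω i v :=
  ((hasWeakPartial_weakPartial hu i).sub (hasWeakPartial_weakPartial hv i)).weakPartial_eq hΩ

theorem sub_mem_H1 {u v : L2 Ω} (hu : u ∈ H1 Ω) (hv : v ∈ H1 Ω) : u - v ∈ H1 Ω :=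
  fun i => ⟨_, (hasWeakPartial_weakPartial hu i).sub (hasWeakPartial_weakPartial hv i)⟩

theorem sub_mem_H2 (hΩ : IsOpen Ω) {u v : L2 Ω} (hu : u ∈ H2 Ω) (hv : v ∈ H2 Ω) :
    u - v ∈ H2 Ω :=
  ⟨sub_mem_H1 hu.1 hv.1, fun i => by
    rw [weakPartial_sub hΩ hu.1 hv.1]
    exact sub_mem_H1 (hu.2 i) (hv.2 i)⟩

theorem weakLaplacian_sub (hΩ : IsOpen Ω) {u v : L2 Ω} (hu : u ∈ H2 Ω) (hv : v ∈ H2 Ω) :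
    weakLaplacian Ω (u - v) = weakLaplacian Ω u - weakLaplacian Ω v := by
  simp only [weakLaplacian, ← Finset.sum_sub_distrib]
  refine Finset.sum_congr rfl fun i _ => ?_
  rw [weakPartial_sub hΩ hu.1 hv.1, weakPartial_sub hΩ (hu.2 i) (hv.2 i)]

theorem gradInner_sub_left (hΩ : IsOpen Ω) {u v : L2 Ω} (hu : u ∈ H1 Ω) (hv : v ∈ H1 Ω)
    (w : L2 Ω) : gradInner Ω (u - v) w = gradInner Ω u w - gradInner Ω v w := by
  simp only [gradInner, ← Finset.sum_sub_distrib]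
  refine Finset.sum_congr rfl fun i _ => ?_
  rw [weakPartial_sub hΩ hu hv, inner_sub_left]

/-! ### The graph of the gradient on `H¹₀(Ω)` -/

theorem H10Graph_induction {P : GraphSpace Ω → Prop} (hP : IsClosed {p | P p})
    (h : ∀ p ∈ testGraph Ω, P p) {p : GraphSpace Ω} (hp : p ∈ H10Graph Ω) : P p :=
  closure_minimal (s := (testGraph Ω : Set (GraphSpace Ω))) h hP hp

/-- Both sides are continuous in p, so integration by parts passes from test functions to their
closure. Green's formula rests on this. -/
theorem HasWeakPartial.inner_eq_of_mem {i : Fin d} {u g : L2 Ω} (hu : HasWeakPartial Ω i u g)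
    {p : GraphSpace Ω} (hp : p ∈ H10Graph Ω) : ⟪u, p.snd i⟫_ℝ = -⟪g, p.fst⟫_ℝ :=
  H10Graph_induction (P := fun p => ⟪u, p.snd i⟫_ℝ = -⟪g, p.fst⟫_ℝ)
    (isClosed_eq (by fun_prop) (by fun_prop)) (hasWeakPartial_iff.mp hu) hp

theorem hasWeakPartial_of_mem_testGraph {p : GraphSpace Ω} (hp : p ∈ testGraph Ω) (i : Fin d) :
    HasWeakPartial Ω i p.fst (p.snd i) := by
  obtain ⟨φ, h, h1, h2⟩ := hp
  intro χ k
  have := IsTestFunction.integral_mul_partialDeriv h.1 k i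
  convert this using 1
  · refine integral_congr_ae ?_
    filter_upwards [h1] with x hx
    rw [hx]
  · congr 1
    refine integral_congr_ae ?_
    filter_upwards [h2 i] with x hx
    rw [hx]

/-- Weak differentiation is a closed operator: for a fixed test pair q the defining identity
survives limits in p. -/
theorem hasWeakPartial_of_mem {p : GraphSpace Ω} (hp : p ∈ H10Graph Ω) (i : Fin d) :
    HasWeakPartial Ω i p.fst (p.snd i) := by
  rw [hasWeakPartial_iff]
  intro q hq
  exact H10Graph_induction (P := fun p => ⟪p.fst, q.snd i⟫_ℝ = -⟪p.snd i, q.fst⟫_ℝ)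
    (isClosed_eq (by fun_prop) (by fun_prop))
    (fun p hp => hasWeakPartial_iff.mp (hasWeakPartial_of_mem_testGraph hp i) q hq) hp

theorem weakPartial_of_mem (hΩ : IsOpen Ω) {p : GraphSpace Ω} (hp : p ∈ H10Graph Ω) (i : Fin d) :
    weakPartial Ω i p.fst = p.snd i :=
  (hasWeakPartial_of_mem hp i).weakPartial_eq hΩ

theorem eLpNorm_sub_eq_edist {u v : L2 Ω} {φ : Space d → ℝ}
    (h : v =ᵐ[(volume : Measure (Space d)).restrict Ω] φ) :
    eLpNorm (fun x => u x - φ x) 2 (volume.restrict Ω) = edist u v := by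
  rw [Lp.edist_def]
  refine eLpNorm_congr_ae ?_
  filter_upwards [h] with x hx
  simp [hx]

theorem fst_mem_H10 (hΩ : IsOpen Ω) {p : GraphSpace Ω} (hp : p ∈ H10Graph Ω) :
    p.fst ∈ H10 Ω := by
  refine ⟨fun i => ⟨_, hasWeakPartial_of_mem hp i⟩, fun η hη => ?_⟩
  -- In the sup metric of the plain product, a single distance bound controls u and every partial
  -- derivative at once.
  have hc : Continuous fun q : GraphSpace Ω => (q.fst, fun i => q.snd i) := by fun_prop
  have := map_mem_closure hc hp (mapsTo_image _ _)
  obtain ⟨-, ⟨q, ⟨φ, h, h1, h2⟩, rfl⟩, hq⟩ := EMetric.mem_closure_iff.mp this η hη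
  rw [Prod.edist_eq, max_lt_iff, edist_pi_def, Finset.sup_lt_iff hη] at hq
  refine ⟨φ, h, ?_, fun i => ?_⟩
  · rw [eLpNorm_sub_eq_edist h1]
    exact hq.1
  · rw [eLpNorm_sub_eq_edist (h2 i), weakPartial_of_mem hΩ hp]
    exact hq.2 i (Finset.mem_univ i)

/-- The pair `(u, ∇u)`. -/
def gradPair {d : ℕ} (Ω : Set (Space d)) (u : L2 Ω) : GraphSpace Ω :=
  WithLp.toLp 2 (u, WithLp.toLp 2 fun i => weakPartial Ω i u)

/-- Converse of `fst_mem_H10`: approximation within η in each component is density for the sup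
metric, and the passage to the L² product is continuous. -/
theorem gradPair_mem {u : L2 Ω} (hu : u ∈ H10 Ω) : gradPair Ω u ∈ H10Graph Ω := by
  have hc : Continuous fun q : L2 Ω × (Fin d → L2 Ω) =>
      (WithLp.toLp 2 (q.1, WithLp.toLp 2 q.2) : GraphSpace Ω) := by fun_prop
  have key : (u, fun i => weakPartial Ω i u) ∈ closure
      {q : L2 Ω × (Fin d → L2 Ω) |
        (WithLp.toLp 2 (q.1, WithLp.toLp 2 q.2) : GraphSpace Ω) ∈ testGraph Ω} := by
    refine EMetric.mem_closure_iff.mpr fun η hη => ?_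
    obtain ⟨φ, h, h1, h2⟩ := hu.2 η hη
    refine ⟨(h.pair.fst, fun i => h.pair.snd i), h.pair_mem, ?_⟩
    rw [Prod.edist_eq, max_lt_iff, edist_pi_def, Finset.sup_lt_iff hη]
    refine ⟨?_, fun i _ => ?_⟩
    · rwa [eLpNorm_sub_eq_edist (v := h.pair.fst) (MemLp.coeFn_toLp h.memLp)] at h1
    · have := h2 i
      rwa [eLpNorm_sub_eq_edist (v := h.pair.snd i)
        (MemLp.coeFn_toLp (h.partialDeriv i).memLp)] at this
  exact map_mem_closure (t := testGraph Ω) hc key fun q hq => hq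

theorem gradInner_eq_inner_gradPair (u v : L2 Ω) :
    gradInner Ω u v = ⟪(gradPair Ω u).snd, (gradPair Ω v).snd⟫_ℝ := by
  rw [PiLp.inner_apply]
  rfl

theorem gradPair_fst_of_mem (hΩ : IsOpen Ω) {p : GraphSpace Ω} (hp : p ∈ H10Graph Ω) :
    gradPair Ω p.fst = p := by
  refine WithLp.ofLp_injective 2 (Prod.ext rfl (WithLp.ofLp_injective 2 (funext fun i => ?_)))
  exact weakPartial_of_mem hΩ hp i

theorem sub_mem_H10 (hΩ : IsOpen Ω) {u v : L2 Ω} (hu : u ∈ H10 Ω) (hv : v ∈ H10 Ω) :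
    u - v ∈ H10 Ω :=
  fst_mem_H10 hΩ ((H10Graph Ω).sub_mem (gradPair_mem hu) (gradPair_mem hv))

/-- The Poincaré inequality on `H¹₀(Ω)`, for one partial derivative. -/
theorem norm_fst_le (hΩ : MeasurableSet Ω) {R : ℝ} (hR0 : 0 ≤ R) (hR : ∀ x ∈ Ω, ‖x‖ ≤ R)
    (i : Fin d) {p : GraphSpace Ω} (hp : p ∈ H10Graph Ω) : ‖p.fst‖ ≤ 2 * R * ‖p.snd i‖ := by
  refine H10Graph_induction (P := fun p => ‖p.fst‖ ≤ 2 * R * ‖p.snd i‖)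
    (isClosed_le (by fun_prop) (by fun_prop)) ?_ hp
  rintro q ⟨φ, h, h1, h2⟩
  refine le_of_sq_le_sq ?_ (by positivity)
  rw [mul_pow, norm_sq_eq_integral h1, norm_sq_eq_integral (h2 i)]
  exact h.integral_sq_le hΩ i hR

/-- One coordinate direction suffices; `NeZero d` supplies the index 0. -/
theorem exists_poincare [NeZero d] (hΩ : MeasurableSet Ω) (hb : Bornology.IsBounded Ω) :
    ∃ C : ℝ, 0 < C ∧ ∀ p ∈ H10Graph Ω, ‖p.fst‖ ≤ C * ‖p.snd‖ := by
  obtain ⟨R, hR0, hR⟩ := hb.exists_pos_norm_le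
  refine ⟨2 * R, by positivity, fun p hp => (norm_fst_le hΩ hR0.le hR 0 hp).trans ?_⟩
  gcongr
  exact PiLp.norm_apply_le _ _

/-! ### Solvability of elliptic problems on `H¹₀(Ω)` -/

/-- The bilinear form `a (y, y') + b (x, x')` of the pairs `(x, y)`, `(x', y')` in a subspace of
`X × Y`. -/
def ellipticForm {X Y : Type*} [NormedAddCommGroup X] [InnerProductSpace ℝ X]
    [NormedAddCommGroup Y] [InnerProductSpace ℝ Y] (K : Submodule ℝ (WithLp 2 (X × Y)))
    (a b : ℝ) : K →L[ℝ] K →L[ℝ] ℝ :=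
  a • (innerSL ℝ).bilinearComp ((WithLp.sndL 2 ℝ X Y).comp K.subtypeL)
      ((WithLp.sndL 2 ℝ X Y).comp K.subtypeL) +
    b • (innerSL ℝ).bilinearComp ((WithLp.fstL 2 ℝ X Y).comp K.subtypeL)
      ((WithLp.fstL 2 ℝ X Y).comp K.subtypeL)

section Abstract

variable {X Y : Type*} [NormedAddCommGroup X] [InnerProductSpace ℝ X]
  [NormedAddCommGroup Y] [InnerProductSpace ℝ Y] {K : Submodule ℝ (WithLp 2 (X × Y))}

theorem ellipticForm_apply (a b : ℝ) (p q : K) :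
    ellipticForm K a b p q =
      a * ⟪p.1.snd, q.1.snd⟫_ℝ + b * ⟪p.1.fst, q.1.fst⟫_ℝ := rfl

/-- A Poincaré inequality makes `ellipticForm` coercive. -/
theorem isCoercive_ellipticForm {C : ℝ} (hC : 0 < C) (hP : ∀ p ∈ K, ‖p.fst‖ ≤ C * ‖p.snd‖)
    {a b : ℝ} (ha : 0 < a) (hb : 0 ≤ b) : IsCoercive (ellipticForm K a b) := by
  -- The Poincaré bound gives ‖p‖² ≤ (1 + C²) ‖p.snd‖², so the gradient term alone is coercive and b
  -- = 0 is allowed.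
  refine ⟨a / (1 + C ^ 2), by positivity, fun p => ?_⟩
  rw [ellipticForm_apply, real_inner_self_eq_norm_sq, real_inner_self_eq_norm_sq]
  have h1 : ‖p.1.fst‖ ^ 2 ≤ C ^ 2 * ‖p.1.snd‖ ^ 2 := by
    rw [← mul_pow]
    gcongr
    exact hP _ p.2
  have h2 : ‖p‖ * ‖p‖ = ‖p.1.fst‖ ^ 2 + ‖p.1.snd‖ ^ 2 := by
    rw [← sq, ← WithLp.prod_norm_sq_eq_of_L2]
    rfl
  have h3 : a / (1 + C ^ 2) * (‖p‖ * ‖p‖) ≤ a * ‖p.1.snd‖ ^ 2 := by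
    rw [h2, div_mul_eq_mul_div, div_le_iff₀ (by positivity)]
    nlinarith
  rw [mul_assoc]
  nlinarith [mul_nonneg hb (sq_nonneg ‖p.1.fst‖)]

/-- Lax–Milgram: the coercive form induces an isomorphism of K, which is inverted at the Riesz
representative k of q ↦ ⟪F, q.fst⟫. -/
theorem existsUnique_of_poincare [CompleteSpace K] {C : ℝ} (hC : 0 < C)
    (hP : ∀ p ∈ K, ‖p.fst‖ ≤ C * ‖p.snd‖) {a b : ℝ} (ha : 0 < a) (hb : 0 ≤ b) (F : X) :
    ∃! p, p ∈ K ∧ ∀ q ∈ K, a * ⟪p.snd, q.snd⟫_ℝ + b * ⟪p.fst, q.fst⟫_ℝ = ⟪F, q.fst⟫_ℝ := by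
  have hB := isCoercive_ellipticForm hC hP ha hb
  have hF : ∀ q : K, ⟪(InnerProductSpace.toDual ℝ K).symm
      ((innerSL ℝ F).comp ((WithLp.fstL 2 ℝ X Y).comp K.subtypeL)), q⟫_ℝ = ⟪F, q.1.fst⟫_ℝ :=
    fun q => InnerProductSpace.toDual_symm_apply
  generalize (InnerProductSpace.toDual ℝ K).symm
    ((innerSL ℝ F).comp ((WithLp.fstL 2 ℝ X Y).comp K.subtypeL)) = k at hF
  refine ⟨hB.continuousLinearEquivOfBilin.symm k, ⟨Subtype.property _, fun q hq => ?_⟩,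
    fun p hp => ?_⟩
  · have := hB.continuousLinearEquivOfBilin_apply (hB.continuousLinearEquivOfBilin.symm k) ⟨q, hq⟩
    rw [ContinuousLinearEquiv.apply_symm_apply, hF] at this
    exact this.symm
  · refine congrArg Subtype.val (a₁ := (⟨p, hp.1⟩ : K)) ?_
    rw [ContinuousLinearEquiv.eq_symm_apply]
    refine ext_inner_right ℝ fun q => ?_
    rw [hB.continuousLinearEquivOfBilin_apply, hF, ellipticForm_apply, hp.2 _ q.2]

end Abstract

theorem existsUnique_elliptic [NeZero d] (hΩ : IsOpen Ω) (hb : Bornology.IsBounded Ω)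
    {a b : ℝ} (ha : 0 < a) (hb0 : 0 ≤ b) (F : L2 Ω) :
    ∃! w, w ∈ H10 Ω ∧ ∀ v ∈ H10 Ω, a * gradInner Ω w v + b * ⟪w, v⟫_ℝ = ⟪F, v⟫_ℝ := by
  obtain ⟨C, hC, hP⟩ := exists_poincare hΩ.measurableSet hb
  obtain ⟨p, ⟨hp, hp'⟩, hu⟩ := existsUnique_of_poincare hC hP ha hb0 F
  refine ⟨p.fst, ⟨fst_mem_H10 hΩ hp, fun v hv => ?_⟩, fun w hw => ?_⟩
  · rw [gradInner_eq_inner_gradPair, gradPair_fst_of_mem hΩ hp]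
    exact hp' _ (gradPair_mem hv)
  · refine congrArg WithLp.fst (hu (gradPair Ω w) ⟨gradPair_mem hw.1, fun q hq => ?_⟩)
    have := hw.2 _ (fst_mem_H10 hΩ hq)
    rwa [gradInner_eq_inner_gradPair, gradPair_fst_of_mem hΩ hq] at this

theorem eq_zero_of_gradInner_self [NeZero d] (hΩ : IsOpen Ω) (hb : Bornology.IsBounded Ω)
    {w : L2 Ω} (hw : w ∈ H10 Ω) (h : gradInner Ω w w ≤ 0) : w = 0 := by
  obtain ⟨C, hC, hP⟩ := exists_poincare hΩ.measurableSet hb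
  rw [gradInner_eq_inner_gradPair, real_inner_self_eq_norm_sq] at h
  have h0 : ‖(gradPair Ω w).snd‖ = 0 := by nlinarith [norm_nonneg (gradPair Ω w).snd]
  have := hP _ (gradPair_mem hw)
  rw [h0, mul_zero] at this
  exact norm_le_zero_iff.mp this

/-! ### Green's formula -/

/-- Integrate each ∂_i u by parts against v; membership of v in H¹₀ removes the boundary term. -/
theorem gradInner_eq_neg_inner_weakLaplacian {u v : L2 Ω} (hu : u ∈ H2 Ω) (hv : v ∈ H10 Ω) :
    gradInner Ω u v = -⟪weakLaplacian Ω u, v⟫_ℝ := by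
  rw [gradInner, weakLaplacian, sum_inner, ← Finset.sum_neg_distrib]
  exact Finset.sum_congr rfl fun i _ =>
    (hasWeakPartial_weakPartial (hu.2 i) i).inner_eq_of_mem (gradPair_mem hv)

theorem gradInner_comm (u v : L2 Ω) : gradInner Ω u v = gradInner Ω v u :=
  Finset.sum_congr rfl fun _ _ => real_inner_comm _ _

theorem toLp_mem_H10 (hΩ : IsOpen Ω) {φ : Space d → ℝ} (h : IsTestFunction Ω φ) :
    h.memLp.toLp φ ∈ H10 Ω :=
  fst_mem_H10 hΩ ((testGraph Ω).le_topologicalClosure h.pair_mem)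

/-- Test functions belong to H¹₀, so this is the fundamental lemma of the calculus of variations. -/
theorem eq_zero_of_inner_H10 (hΩ : IsOpen Ω) {w : L2 Ω} (h : ∀ v ∈ H10 Ω, ⟪w, v⟫_ℝ = 0) :
    w = 0 := by
  have key := hΩ.ae_eq_zero_of_integral_contDiff_smul_eq_zero
    (μ := (volume : Measure (Space d)).restrict Ω) (f := w)
    (((Lp.memLp w).locallyIntegrable (by norm_num)).locallyIntegrableOn Ω) fun φ h1 h2 h3 => by
      have ht : IsTestFunction Ω φ := ⟨h1, h2, h3⟩
      rw [← h _ (toLp_mem_H10 hΩ ht), inner_eq_integral (φ := φ) (MemLp.coeFn_toLp _)]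
      simp only [smul_eq_mul, mul_comm]
  apply Lp.ext
  filter_upwards [key, ae_restrict_mem hΩ.measurableSet,
    Lp.coeFn_zero ℝ 2 ((volume : Measure (Space d)).restrict Ω)] with x hx hm h0
  rw [hx hm, h0]
  rfl

/-! ### The mixed and the primal problem -/

theorem existsUnique_mixed [NeZero d] (hΩ : IsOpen Ω) (hb : Bornology.IsBounded Ω) {ε : ℝ}
    (hε : 0 < ε) (f : L2 Ω) : ∃! p : L2 Ω × L2 Ω, IsMixedWeakSolution Ω ε f p.1 p.2 := by
  -- Coefficients (ε², 1) with datum f give ψ; coefficients (1, 0) with datum ψ then give u.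
  obtain ⟨ψ, ⟨hψ, hψ'⟩, huψ⟩ := existsUnique_elliptic hΩ hb (pow_pos hε 2) zero_le_one f
  obtain ⟨u, ⟨hu, hu'⟩, huu⟩ := existsUnique_elliptic hΩ hb one_pos le_rfl ψ
  simp only [one_mul, zero_mul, add_zero] at hψ' huψ hu' huu
  refine ⟨(ψ, u), ⟨hψ, hu, hψ', hu'⟩, ?_⟩
  rintro ⟨ψ₂, u₂⟩ ⟨h1, h2, h3, h4⟩
  obtain rfl := huψ ψ₂ ⟨h1, h3⟩
  obtain rfl := huu u₂ ⟨h2, h4⟩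
  rfl

theorem IsPrimalWeakSolution.unique [NeZero d] (hΩ : IsOpen Ω) (hb : Bornology.IsBounded Ω)
    {ε : ℝ} {f w₁ w₂ : L2 Ω} (h₁ : IsPrimalWeakSolution Ω ε f w₁)
    (h₂ : IsPrimalWeakSolution Ω ε f w₂) : w₁ = w₂ := by
  have hz : w₁ - w₂ ∈ H2 Ω ∩ H10 Ω :=
    ⟨sub_mem_H2 hΩ h₁.1.1 h₂.1.1, sub_mem_H10 hΩ h₁.1.2 h₂.1.2⟩
  have e₁ := h₁.2 _ hz
  have e₂ := h₂.2 _ hz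
  have eL := weakLaplacian_sub hΩ h₁.1.1 h₂.1.1
  have eG := gradInner_sub_left hΩ h₁.1.1.1 h₂.1.1.1 (w₁ - w₂)
  -- Subtracting the equations tested with z = w₁ - w₂ gives ε²‖Δz‖² + ‖∇z‖² = 0, so the gradient
  -- term is at most 0 and Poincaré forces z = 0.
  have hL : 0 ≤ ε ^ 2 * ⟪weakLaplacian Ω (w₁ - w₂), weakLaplacian Ω (w₁ - w₂)⟫_ℝ :=
    mul_nonneg (sq_nonneg ε) real_inner_self_nonneg
  -- Only the left factor is expanded; the right one stays as the test function of `e₁` and `e₂`.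
  nth_rw 1 [eL] at hL
  rw [inner_sub_left] at hL
  exact sub_eq_zero.mp (eq_zero_of_gradInner_self hΩ hb hz.2 (by linarith))

theorem IsMixedWeakSolution.weakLaplacian_eq (hΩ : IsOpen Ω) {ε : ℝ} {f ψ u : L2 Ω}
    (h : IsMixedWeakSolution Ω ε f ψ u) (hu : u ∈ H2 Ω) : weakLaplacian Ω u = -ψ := by
  refine eq_neg_of_add_eq_zero_left (eq_zero_of_inner_H10 hΩ fun v hv => ?_)
  have := h.2.2.2 v hv
  rw [gradInner_eq_neg_inner_weakLaplacian hu hv] at this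
  rw [inner_add_left]
  linarith

theorem IsMixedWeakSolution.isPrimalWeakSolution (hΩ : IsOpen Ω) {ε : ℝ} {f ψ u : L2 Ω}
    (h : IsMixedWeakSolution Ω ε f ψ u) (hu : u ∈ H2 Ω) : IsPrimalWeakSolution Ω ε f u := by
  refine ⟨⟨hu, h.2.1⟩, fun v hv => ?_⟩
  -- Here ψ ∈ H¹₀ is the test function in Green's formula for v, which is how the condition Δu = 0
  -- on the boundary enters.
  rw [h.weakLaplacian_eq hΩ hu, inner_neg_left, h.2.2.2 v hv.2, ← h.2.2.1 v hv.2,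
    gradInner_comm ψ v, gradInner_eq_neg_inner_weakLaplacian hv.1 h.1, real_inner_comm]

end MixedPlate

end

theorem theorem2p1 (d : ℕ) (hd : d = 2 ∨ d = 3) (Ω : Set (MixedPlate.Space d))
    (hΩ_open : IsOpen Ω) (hΩ_bdd : Bornology.IsBounded Ω)
    (ε : ℝ) (hε : 0 < ε) (f : MixedPlate.L2 Ω) :
    -- the mixed problem determines `(ψ, u)`
    (∃! p : MixedPlate.L2 Ω × MixedPlate.L2 Ω,
      MixedPlate.IsMixedWeakSolution Ω ε f p.1 p.2) ∧
    -- the primal problem has at most one solution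
    (∀ w₁ w₂ : MixedPlate.L2 Ω, MixedPlate.IsPrimalWeakSolution Ω ε f w₁ →
      MixedPlate.IsPrimalWeakSolution Ω ε f w₂ → w₁ = w₂) ∧
    ∀ ψ u : MixedPlate.L2 Ω, MixedPlate.IsMixedWeakSolution Ω ε f ψ u →
      -- `u` is the solution of the primal problem if and only if `u ∈ H²(Ω)`
      (MixedPlate.IsPrimalWeakSolution Ω ε f u ↔ u ∈ MixedPlate.H2 Ω) ∧
      -- a solution `w` of the primal problem is `u` if and only if `u ∈ H²(Ω)`
      (∀ w : MixedPlate.L2 Ω, MixedPlate.IsPrimalWeakSolution Ω ε f w →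
        (w = u ↔ u ∈ MixedPlate.H2 Ω)) := by
  have : NeZero d := ⟨by omega⟩
  refine ⟨MixedPlate.existsUnique_mixed hΩ_open hΩ_bdd hε f,
    fun _ _ h₁ h₂ => h₁.unique hΩ_open hΩ_bdd h₂,
    fun ψ u h => ⟨⟨fun hu => hu.1.1, h.isPrimalWeakSolution hΩ_open⟩,
      fun w hw => ⟨?_, fun hu => hw.unique hΩ_open hΩ_bdd (h.isPrimalWeakSolution hΩ_open hu)⟩⟩⟩
  rintro rfl
  exact hw.1.1
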